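/- For a finite simple graph $\Gamma$ with vertex set $V$ let $G(\Gamma)=\langle s\in V \mid s^2=1\ (s\in V),\ (ss')^2=1\ (\{s,s'\}\in E(\Gamma))\rangle$ be the right-angled Coxeter group (RACG) based on $\Gamma$. A word $w\in V^*$ is geodesic if its length $|w|$ equals the word length, with respect to $V$, of the element of $G(\Gamma)$ that it represents. Let $f_{Geo(\Gamma)}(r)$ be the number of geodesic words of length $r$, and for a vertex $0$ let $f_{Geo_0(\Gamma)}(r)$ and $f_{Geo^0(\Gamma)}(r)$ be the numbers of those that start, respectively end, with the letter $0$. The geodesic growth series of $G(\Gamma)$ is $\sum_{r\ge 0} f_{Geo(\Gamma)}(r)\,t^r$. The coalescence $\tau\cdot\sigma$ of two rooted trees is the tree obtained from their disjoint union by identifying the two roots. Let $S_1$ and $S_2$ be the trees on $\{0,\dots,9\}$, rooted at $0$, with edge sets $$E(S_1)=\{01,02,13,24,25,36,57,78,79\},\qquad E(S_2)=\{01,02,13,14,25,26,37,78,89\},$$ and let $S_1'$ and $S_2'$ be the trees on $\{0,\dots,10\}$, rooted at $0$, obtained from $S_1$ by subdividing the edge $57$, and from $S_2$ by subdividing the edge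 $01$, with a new vertex $10$. (a) For every finite rooted tree $\tau$ with at least two vertices, the RACGs $G(\tau\cdot S_1)$ and $G(\tau\cdot S_2)$ have distinct geodesic growth series; more precisely, $f_{Geo(\tau\cdot S_1)}(10)\ne f_{Geo(\tau\cdot S_2)}(10)$. (b) For every finite rooted tree $\tau$ with at least two vertices, the RACGs $G(\tau\cdot S_1')$ and $G(\tau\cdot S_2')$ have distinct geodesic growth series; more precisely, $f_{Geo(\tau\cdot S_1')}(10)\ne f_{Geo(\tau\cdot S_2')}(10)$. (c) $f_{Geo_0(S_1')}(r)=f_{Geo_0(S_2')}(r)$ for all $r<8$, while $f_{Geo_0(S_1')}(8)=f_{Geo^0(S_1')}(8)=8919523$ and $f_{Geo_0(S_2')}(8)=f_{Geo^0(S_2')}(8)=8919522$. -/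

import Mathlib

noncomputable section

namespace RACG

universe u v

open Classical in
/-- The Coxeter matrix of the right-angled Coxeter group based on a simple graph: `1` on the
diagonal, `2` for adjacent vertices, and `0` (Mathlib's encoding of `∞`, that is, no relation) for
distinct non-adjacent vertices. -/
def coxeterMatrix {V : Type u} (Γ : SimpleGraph V) : CoxeterMatrix V where
  M := Matrix.of fun s s' => if s = s' then 1 else if Γ.Adj s s' then 2 else 0
  isSymm := by
    ext s s'
    simp only [Matrix.transpose_apply, Matrix.of_apply, eq_comm (a := s') (b := s),
      Γ.adj_comm s' s]
  diagonal := by simp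
  off_diagonal := by
    intro s s' h
    simp only [Matrix.of_apply, h, if_false]
    split_ifs <;> decide

/-- The right-angled Coxeter group based on `Γ`, as the group with generators the vertices `s`
and relations `s ^ 2 = 1` for all `s`, `(s s') ^ 2 = 1` for all edges `{s, s'}`. -/
abbrev Grp {V : Type u} (Γ : SimpleGraph V) : Type u := (coxeterMatrix Γ).Group

/-- The right-angled Coxeter group with its standard generating set, the vertices of `Γ`. -/
abbrev system {V : Type u} (Γ : SimpleGraph V) : CoxeterSystem (coxeterMatrix Γ) (Grp Γ) :=
  (coxeterMatrix Γ).toCoxeterSystem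

/-- `Geo(Γ)`: the words over the vertices of `Γ` that are geodesic in the right-angled Coxeter
group, i.e. whose length is the word length of the element they represent. -/
def Geo {V : Type u} (Γ : SimpleGraph V) : Set (List V) :=
  {w | (system Γ).length ((system Γ).wordProd w) = w.length}

/-- The geodesic words that start with the letter `x`. -/
def GeoStart {V : Type u} (Γ : SimpleGraph V) (x : V) : Set (List V) :=
  {w | w ∈ Geo Γ ∧ w.head? = some x}

/-- The geodesic words that end with the letter `x`. -/
def GeoEnd {V : Type u} (Γ : SimpleGraph V) (x : V) : Set (List V) :=
  {w | w ∈ Geo Γ ∧ w.getLast? = some x}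

/-- The strict growth function of a language. Over a finite alphabet the sets counted here are
finite. -/
def growth {V : Type u} (L : Set (List V)) (r : ℕ) : ℕ :=
  {w | w ∈ L ∧ w.length = r}.ncard

/-- The geodesic growth series of the right-angled Coxeter group based on `Γ`. -/
def geodesicGrowthSeries {V : Type u} (Γ : SimpleGraph V) : PowerSeries ℕ :=
  PowerSeries.mk (growth (Geo Γ))

/-- The coalescence of the rooted graphs `(τ, a)` and `(σ, b)`: their disjoint union with the
roots merged. The merged root is `Sum.inl a`. -/
def coalescence {V : Type u} {W : Type v} (τ : SimpleGraph V) (a : V) (σ : SimpleGraph W) (b : W) :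
    SimpleGraph (V ⊕ {w : W // w ≠ b}) where
  Adj
    | .inl x, .inl y => τ.Adj x y
    | .inl x, .inr w => x = a ∧ σ.Adj b w
    | .inr w, .inl x => x = a ∧ σ.Adj b w
    | .inr w, .inr w' => σ.Adj w w'
  symm := ⟨by
    rintro (x | w) (y | w') h
    · exact h.symm
    · exact h
    · exact h
    · exact h.symm⟩
  loopless := ⟨by
    rintro (x | w) h
    · exact h.ne rfl
    · exact h.ne rfl⟩

/-- The graph on `Fin n` with the listed edges. -/
def ofEdges (n : ℕ) (l : List (Fin n × Fin n)) : SimpleGraph (Fin n) :=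
  SimpleGraph.fromRel fun i j => (i, j) ∈ l

/-- The ten-vertex tree `S₁`, rooted at `0`. -/
def S₁ : SimpleGraph (Fin 10) :=
  ofEdges 10 [(0, 1), (0, 2), (1, 3), (2, 4), (2, 5), (3, 6), (5, 7), (7, 8), (7, 9)]

/-- The ten-vertex tree `S₂`, rooted at `0`. -/
def S₂ : SimpleGraph (Fin 10) :=
  ofEdges 10 [(0, 1), (0, 2), (1, 3), (1, 4), (2, 5), (2, 6), (3, 7), (7, 8), (8, 9)]

/-- The eleven-vertex version of `S₁`, rooted at `0`: the edge `{5, 7}` is subdivided by a new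
vertex `10`. -/
def S₁ext : SimpleGraph (Fin 11) :=
  ofEdges 11 [(0, 1), (0, 2), (1, 3), (2, 4), (2, 5), (3, 6), (5, 10), (10, 7), (7, 8), (7, 9)]

/-- The eleven-vertex version of `S₂`, rooted at `0`: the edge `{0, 1}` is subdivided by a new
vertex `10`. -/
def S₂ext : SimpleGraph (Fin 11) :=
  ofEdges 11 [(0, 10), (10, 1), (0, 2), (1, 3), (1, 4), (2, 5), (2, 6), (3, 7), (7, 8), (8, 9)]

end RACG

end

/-!
The sign vectors of the geometric representation show that the geodesic words are those read by an
automaton whose states are sets of letters: reading `s` is allowed outside the state `D`, and leads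
to `{s} ∪ {t ∈ D | t commutes with s}`. Geodesic words are therefore counted by powers of a transfer
operator. Split a word over a coalescence after its longest prefix over the second graph `σ`. What
is left to read depends on the prefix only through whether the prefix can end with the root, and the
number of continuations is smaller if it can. So the counts for the coalescence are monotone in
three sequences attached to `σ`: the numbers of geodesic words, of those starting with the root, and
of those starting and ending with the root. For each of the two pairs of trees these sequences are
comparable up to the required length. The trees have no triangles, so the states reached have at
most two elements, which makes their sequences computable.
-/

noncomputable section

namespace RACG

section Automaton

variable {V : Type*} {Γ : SimpleGraph V}

/-! ### The reflection representation -/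

open Classical in
/-- The generator `s` acting on the contragredient of the geometric representation: `c t` is the
value at the simple root of `t`, and distinct non-adjacent simple roots have inner product `-1`. -/
def reflect (Γ : SimpleGraph V) (s : V) (c : V → ℤ) : V → ℤ := fun t =>
  if t = s then -c s else if Γ.Adj s t then c t else c t + 2 * c s

theorem reflect_self (s : V) (c : V → ℤ) : reflect Γ s c s = -c s := by simp [reflect]

theorem reflect_of_adj {s t : V} (h : Γ.Adj s t) (c : V → ℤ) : reflect Γ s c t = c t := by
  simp [reflect, h.ne', h]

theorem reflect_of_not_adj {s t : V} (hne : t ≠ s) (h : ¬Γ.Adj s t) (c : V → ℤ) :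
    reflect Γ s c t = c t + 2 * c s := by
  simp [reflect, hne, h]

theorem reflect_reflect (s : V) (c : V → ℤ) : reflect Γ s (reflect Γ s c) = c := by
  funext t
  rcases eq_or_ne t s with rfl | hts
  · simp [reflect_self]
  by_cases h : Γ.Adj s t
  · simp [reflect_of_adj h]
  · simp [reflect_of_not_adj hts h, reflect_self]

theorem reflect_comm {s t : V} (h : Γ.Adj s t) (c : V → ℤ) :
    reflect Γ s (reflect Γ t c) = reflect Γ t (reflect Γ s c) := by
  funext x
  rcases eq_or_ne x s with rfl | hs
  · simp [reflect_self, reflect_of_adj h.symm]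
  rcases eq_or_ne x t with rfl | ht
  · simp [reflect_self, reflect_of_adj h]
  by_cases hxs : Γ.Adj s x <;> by_cases hxt : Γ.Adj t x <;>
    simp [reflect, hs, ht, hxs, hxt, h.ne, h.ne', h, h.symm]
  ring

theorem coxeterMatrix_of_adj {s t : V} (h : Γ.Adj s t) : coxeterMatrix Γ s t = 2 := by
  simp [coxeterMatrix, h.ne, h]

theorem coxeterMatrix_of_not_adj {s t : V} (hne : s ≠ t) (h : ¬Γ.Adj s t) :
    coxeterMatrix Γ s t = 0 := by
  simp [coxeterMatrix, hne, h]

theorem isLiftable_reflect (Γ : SimpleGraph V) :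
    (coxeterMatrix Γ).IsLiftable (G := Function.End (V → ℤ)) (reflect Γ) := by
  intro s t
  rcases eq_or_ne s t with rfl | hne
  · rw [CoxeterMatrix.diagonal, pow_one]
    exact funext (reflect_reflect s)
  by_cases h : Γ.Adj s t
  · rw [coxeterMatrix_of_adj h, pow_two]
    funext c
    change reflect Γ s (reflect Γ t (reflect Γ s (reflect Γ t c))) = c
    rw [reflect_comm h, reflect_reflect, reflect_reflect]
  · rw [coxeterMatrix_of_not_adj hne h, pow_zero]

/-- The contragredient of the geometric representation. -/
def rep (Γ : SimpleGraph V) : Grp Γ →* Function.End (V → ℤ) :=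
  (system Γ).lift ⟨_, isLiftable_reflect Γ⟩

theorem rep_simple (s : V) (c : V → ℤ) : rep Γ ((system Γ).simple s) c = reflect Γ s c :=
  congrFun (CoxeterSystem.lift_apply_simple (G := Function.End (V → ℤ)) (system Γ)
    (isLiftable_reflect Γ) s) c

/-- The values at the simple roots of the translate of a point inside the fundamental chamber by
`g⁻¹`; the sign of `coord g s` tells whether `s` is a right descent of `g`. -/
def coord (g : Grp Γ) : V → ℤ := rep Γ g⁻¹ fun _ => 1

theorem coord_one : coord (1 : Grp Γ) = fun _ => 1 := by
  rw [coord, inv_one, map_one]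
  rfl

theorem coord_mul_simple (g : Grp Γ) (s : V) :
    coord (g * (system Γ).simple s) = reflect Γ s (coord g) := by
  rw [coord, mul_inv_rev, CoxeterSystem.inv_simple, map_mul]
  exact rep_simple s _

/-- Inequalities satisfied by the coordinates of every chamber of the Tits cone: the point lies on
no wall, and not on the negative side of the affine relation between two non-commuting roots. -/
structure IsRegular (Γ : SimpleGraph V) (c : V → ℤ) : Prop where
  ne_zero : ∀ t, c t ≠ 0
  add_pos : ∀ ⦃s t⦄, s ≠ t → ¬Γ.Adj s t → 0 < c s + c t

theorem IsRegular.reflect {c : V → ℤ} (hc : IsRegular Γ c) {s : V} (hs : 0 < c s) :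
    IsRegular Γ (reflect Γ s c) where
  ne_zero t := by
    rcases eq_or_ne t s with rfl | hts
    · rw [reflect_self]; lia
    by_cases hadj : Γ.Adj s t
    · rw [reflect_of_adj hadj]; exact hc.ne_zero t
    · have := hc.add_pos hts.symm hadj
      rw [reflect_of_not_adj hts hadj]; lia
  add_pos x y hxy hadj := by
    have hsum := hc.add_pos hxy hadj
    rcases eq_or_ne x s with rfl | hxs
    · rw [reflect_self, reflect_of_not_adj hxy.symm hadj]; lia
    rcases eq_or_ne y s with rfl | hys
    · rw [reflect_self, reflect_of_not_adj hxy fun h => hadj h.symm]; lia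
    have reflect_ge (t : V) (hts : t ≠ s) : c t ≤ RACG.reflect Γ s c t := by
      by_cases h : Γ.Adj s t
      · rw [reflect_of_adj h]
      · rw [reflect_of_not_adj hts h]; lia
    have := reflect_ge x hxs
    have := reflect_ge y hys
    lia

/-! ### The geodesic automaton -/

/-- The transition of the geodesic automaton: a state is the set of letters in which the words
leading to it can end after commutations. -/
def next (Γ : SimpleGraph V) (D : Set V) (s : V) : Set V := insert s (D ∩ Γ.neighborSet s)

/-- The words that can be read from the state `D`. -/
def Readable (Γ : SimpleGraph V) : Set V → List V → Prop
  | _, [] => True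
  | D, s :: w => s ∉ D ∧ Readable Γ (next Γ D s) w

/-- The state reached from `D` by reading `w`. -/
def state (Γ : SimpleGraph V) (D : Set V) (w : List V) : Set V := w.foldl (next Γ) D

theorem mem_next {D : Set V} {s t : V} : t ∈ next Γ D s ↔ t = s ∨ t ∈ D ∧ Γ.Adj s t := Iff.rfl

theorem next_mono (s : V) : Monotone fun D => next Γ D s :=
  fun _ _ h => Set.insert_subset_insert (Set.inter_subset_inter_left _ h)

theorem next_empty (s : V) : next Γ ∅ s = {s} := by simp [next]

theorem readable_append {D : Set V} {w w' : List V} :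
    Readable Γ D (w ++ w') ↔ Readable Γ D w ∧ Readable Γ (state Γ D w) w' := by
  induction w generalizing D with
  | nil => simp [Readable, state]
  | cons t w ih => simp [Readable, ih, state, and_assoc]

theorem readable_singleton {D : Set V} {s : V} : Readable Γ D [s] ↔ s ∉ D :=
  iff_of_eq (and_true _)

theorem state_append (D : Set V) (w w' : List V) :
    state Γ D (w ++ w') = state Γ (state Γ D w) w' := List.foldl_append

theorem state_singleton (D : Set V) (s : V) : state Γ D [s] = next Γ D s := rfl

theorem setOf_reflect_neg {c : V → ℤ} (hc : IsRegular Γ c) {s : V} (hs : 0 < c s) :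
    {t | reflect Γ s c t < 0} = next Γ {t | c t < 0} s := by
  ext t
  rw [mem_next, Set.mem_ofPred_eq, Set.mem_ofPred_eq]
  rcases eq_or_ne t s with rfl | hts
  · simp [reflect_self, hs]
  by_cases hadj : Γ.Adj s t
  · simp [reflect_of_adj hadj, hts, hadj]
  · have := hc.add_pos hts.symm hadj
    simp only [reflect_of_not_adj hts hadj, hts, hadj, and_false, or_false, iff_false]
    lia

theorem isRegular_coord_and_state_eq {w : List V} (hw : Readable Γ ∅ w) :
    IsRegular Γ (coord ((system Γ).wordProd w)) ∧
      state Γ ∅ w = {t | coord ((system Γ).wordProd w) t < 0} := by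
  induction w using List.reverseRecOn with
  | nil =>
    rw [CoxeterSystem.wordProd_nil, coord_one]
    exact ⟨⟨by simp, by simp⟩, by simp [state]⟩
  | append_singleton w s ih =>
    obtain ⟨hw, hs⟩ := readable_append.1 hw
    obtain ⟨hreg, hstate⟩ := ih hw
    have hpos : 0 < coord ((system Γ).wordProd w) s := by
      rw [readable_singleton, hstate, Set.mem_ofPred_eq, not_lt] at hs
      exact lt_of_le_of_ne hs (hreg.ne_zero s).symm
    rw [CoxeterSystem.wordProd_append, CoxeterSystem.wordProd_singleton, coord_mul_simple,
      state_append, state_singleton, hstate, setOf_reflect_neg hreg hpos]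
    exact ⟨hreg.reflect hpos, rfl⟩

theorem state_eq_of_wordProd_eq {w w' : List V} (hw : Readable Γ ∅ w) (hw' : Readable Γ ∅ w')
    (h : (system Γ).wordProd w = (system Γ).wordProd w') : state Γ ∅ w = state Γ ∅ w' := by
  rw [(isRegular_coord_and_state_eq hw).2, (isRegular_coord_and_state_eq hw').2, h]

theorem simple_comm {s t : V} (h : Γ.Adj s t) :
    (system Γ).simple s * (system Γ).simple t = (system Γ).simple t * (system Γ).simple s := by
  have hpow := (system Γ).simple_mul_simple_pow s t
  rw [coxeterMatrix_of_adj h, pow_two] at hpow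
  simpa only [mul_inv_rev, CoxeterSystem.inv_simple] using eq_inv_of_mul_eq_one_left hpow

theorem length_mul_simple_lt_of_mem_state {w : List V} {s : V} (hs : s ∈ state Γ ∅ w) :
    (system Γ).length ((system Γ).wordProd w * (system Γ).simple s) < w.length := by
  induction w using List.reverseRecOn with
  | nil => exact absurd hs (Set.notMem_empty s)
  | append_singleton w u ih =>
    rw [state_append, state_singleton, mem_next] at hs
    rw [CoxeterSystem.wordProd_append, CoxeterSystem.wordProd_singleton, List.length_append,
      List.length_singleton, Nat.lt_succ_iff]
    rcases hs with rfl | ⟨hs, hus⟩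
    · rw [CoxeterSystem.simple_mul_simple_cancel_right]
      exact (system Γ).length_wordProd_le w
    · rw [mul_assoc, simple_comm hus, ← mul_assoc]
      have := (system Γ).length_mul_simple ((system Γ).wordProd w * (system Γ).simple s) u
      have := ih hs
      lia

theorem mem_Geo_iff_isReduced {w : List V} : w ∈ Geo Γ ↔ (system Γ).IsReduced w := Iff.rfl

theorem readable_of_mem_Geo {w : List V} (hw : w ∈ Geo Γ) : Readable Γ ∅ w := by
  induction w using List.reverseRecOn with
  | nil => trivial
  | append_singleton w s ih =>
    have hinit : w ∈ Geo Γ :=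
      mem_Geo_iff_isReduced.2 (by simpa using (mem_Geo_iff_isReduced.1 hw).take w.length)
    refine readable_append.2 ⟨ih hinit, readable_singleton.2 fun hs => ?_⟩
    have hshort := length_mul_simple_lt_of_mem_state hs
    rw [Geo, Set.mem_ofPred_eq, CoxeterSystem.wordProd_append, CoxeterSystem.wordProd_singleton,
      List.length_append] at hw
    lia

theorem mem_Geo_of_readable {w : List V} (hw : Readable Γ ∅ w) : w ∈ Geo Γ := by
  induction w using List.reverseRecOn with
  | nil => simp [Geo]
  | append_singleton w s ih =>
    have hinit : (system Γ).length ((system Γ).wordProd w) = w.length :=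
      ih (readable_append.1 hw).1
    obtain ⟨v, hred, hv⟩ := (system Γ).exists_isReduced ((system Γ).wordProd (w ++ [s]))
    have hs : s ∈ state Γ ∅ v := by
      rw [← state_eq_of_wordProd_eq hw (readable_of_mem_Geo hred) hv, state_append]
      exact Set.mem_insert s _
    have hshort := length_mul_simple_lt_of_mem_state hs
    rw [← hred.eq, ← hv, CoxeterSystem.wordProd_append, CoxeterSystem.wordProd_singleton,
      CoxeterSystem.simple_mul_simple_cancel_right, hinit] at hshort
    have := (system Γ).length_mul_simple ((system Γ).wordProd w) s
    rw [Geo, Set.mem_ofPred_eq, CoxeterSystem.wordProd_append, CoxeterSystem.wordProd_singleton,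
      List.length_append, List.length_singleton]
    lia

theorem mem_Geo_iff_readable {w : List V} : w ∈ Geo Γ ↔ Readable Γ ∅ w :=
  ⟨readable_of_mem_Geo, mem_Geo_of_readable⟩

end Automaton

/-! ### Counting words -/

section Transfer

variable {V : Type*} {Γ : SimpleGraph V}

open Classical in
/-- The transfer operator of the geodesic automaton restricted to the letters in `X`: it sends a
weight on states to the total weight of the states reached by reading one letter of `X`. -/
def transfer (Γ : SimpleGraph V) (X : Finset V) : Module.End ℕ (Set V → ℕ) where
  toFun φ D := ∑ s ∈ X, if s ∈ D then 0 else φ (next Γ D s)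
  map_add' φ ψ := by
    funext D
    simp only [Pi.add_apply, ← Finset.sum_add_distrib]
    exact Finset.sum_congr rfl fun s _ => by split_ifs <;> rfl
  map_smul' c φ := by
    funext D
    simp [Finset.mul_sum]

open Classical in
theorem transfer_apply (X : Finset V) (φ : Set V → ℕ) (D : Set V) :
    transfer Γ X φ D = ∑ s ∈ X, if s ∈ D then 0 else φ (next Γ D s) := rfl

theorem transfer_pow_succ_apply (X : Finset V) (n : ℕ) (φ : Set V → ℕ) :
    (transfer Γ X ^ (n + 1)) φ = transfer Γ X ((transfer Γ X ^ n) φ) := by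
  rw [pow_succ', Module.End.mul_apply]

theorem transfer_mono (X : Finset V) : Monotone (transfer Γ X) := fun φ ψ h D => by
  rw [transfer_apply, transfer_apply]
  gcongr with s
  split_ifs
  exacts [le_rfl, h _]

theorem transfer_pow_mono (X : Finset V) (n : ℕ) : Monotone (transfer Γ X ^ n) := by
  rw [Module.End.coe_pow]
  exact (transfer_mono X).iterate n

theorem antitone_transfer (X : Finset V) {φ : Set V → ℕ} (hφ : Antitone φ) :
    Antitone (transfer Γ X φ) := fun D E h => by
  rw [transfer_apply, transfer_apply]
  gcongr with s
  split_ifs with hE hD hD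
  · exact le_rfl
  · exact Nat.zero_le _
  · exact absurd (h hD) hE
  · exact hφ (next_mono s h)

theorem antitone_transfer_pow (X : Finset V) (n : ℕ) {φ : Set V → ℕ} (hφ : Antitone φ) :
    Antitone ((transfer Γ X ^ n) φ) := by
  induction n with
  | zero => exact hφ
  | succ n ih => exact transfer_pow_succ_apply (Γ := Γ) X n φ ▸ antitone_transfer X ih

theorem strictAnti_transfer_univ_one [Fintype V] :
    StrictAnti (transfer Γ Finset.univ (1 : Set V → ℕ)) := fun D E h => by
  rw [transfer_apply, transfer_apply]
  obtain ⟨s, hsE, hsD⟩ := Set.exists_of_ssubset h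
  refine Finset.sum_lt_sum (fun t _ => ?_) ⟨s, Finset.mem_univ s, by simp [hsE, hsD]⟩
  split_ifs with hE hD hD
  exacts [le_rfl, Nat.zero_le _, absurd (h.subset hD) hE, le_rfl]

theorem transfer_congr {X : Finset V} {φ ψ : Set V → ℕ} {D : Set V}
    (h : ∀ s ∈ X, s ∉ D → φ (next Γ D s) = ψ (next Γ D s)) :
    transfer Γ X φ D = transfer Γ X ψ D := by
  rw [transfer_apply, transfer_apply]
  refine Finset.sum_congr rfl fun s hs => ?_
  split_ifs with hD
  exacts [rfl, h s hs hD]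

theorem ncard_setOf_readable [Fintype V] (P : Set (Set V)) (D : Set V) (n : ℕ) :
    {w | Readable Γ D w ∧ state Γ D w ∈ P ∧ w.length = n}.ncard =
      (transfer Γ Finset.univ ^ n) (P.indicator 1) D := by
  classical
  induction n generalizing D with
  | zero =>
    have hnil : {w | Readable Γ D w ∧ state Γ D w ∈ P ∧ w.length = 0} = {w | D ∈ P ∧ w = []} := by
      ext (_ | ⟨s, w⟩) <;> simp [Readable, state]
    rw [hnil]
    by_cases hD : D ∈ P <;> simp [hD]
  | succ n ih =>
    let tails (s : V) : Set (List V) :=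
      {w | s ∉ D ∧ Readable Γ (next Γ D s) w ∧ state Γ (next Γ D s) w ∈ P ∧ w.length = n}
    have tails_finite (s : V) : (tails s).Finite :=
      (List.finite_length_eq V n).subset fun w hw => hw.2.2.2
    have hsplit : {w | Readable Γ D w ∧ state Γ D w ∈ P ∧ w.length = n + 1} =
        ⋃ s, List.cons s '' tails s := by
      ext (_ | ⟨s, w⟩)
      · simp
      · simp [tails, Readable, state, and_assoc]
    have hdisj : Pairwise (Function.onFun Disjoint fun s => List.cons s '' tails s) := by
      intro s t hst
      rw [Function.onFun, Set.disjoint_left]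
      rintro _ ⟨w, -, rfl⟩ ⟨w', -, h⟩
      exact hst (List.cons.inj h).1.symm
    rw [hsplit, Set.ncard_iUnion_of_finite (fun s => (tails_finite s).image _) hdisj,
      finsum_eq_sum_of_fintype, transfer_pow_succ_apply, transfer_apply]
    refine Finset.sum_congr rfl fun s _ => ?_
    rw [Set.ncard_image_of_injective _ List.cons_injective]
    split_ifs with hs
    · simp [tails, hs]
    · simp [tails, hs, ih]

/-- The indicator of the states without `x`, those in which the letter `x` can be read. -/
def avoiding (x : V) : Set V → ℕ := {D | x ∉ D}.indicator 1

theorem growth_Geo [Fintype V] (n : ℕ) :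
    growth (Geo Γ) n = (transfer Γ Finset.univ ^ n) 1 ∅ := by
  rw [← Set.indicator_univ (1 : Set V → ℕ), ← ncard_setOf_readable]
  simp only [growth, mem_Geo_iff_readable, Set.mem_univ, true_and]

theorem growth_GeoStart_zero (x : V) : growth (GeoStart Γ x) 0 = 0 := by
  have : {w | w ∈ GeoStart Γ x ∧ w.length = 0} = ∅ := by
    refine Set.eq_empty_of_forall_notMem fun w ⟨⟨_, hhead⟩, hlen⟩ => ?_
    simp [List.length_eq_zero_iff.1 hlen] at hhead
  rw [growth, this, Set.ncard_empty]

theorem growth_GeoStart_succ [Fintype V] (x : V) (n : ℕ) :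
    growth (GeoStart Γ x) (n + 1) = (transfer Γ Finset.univ ^ n) 1 {x} := by
  have : {w | w ∈ GeoStart Γ x ∧ w.length = n + 1} =
      List.cons x '' {w | Readable Γ {x} w ∧ state Γ {x} w ∈ Set.univ ∧ w.length = n} := by
    ext (_ | ⟨s, w⟩)
    · simp
    · simp only [GeoStart, mem_Geo_iff_readable, Readable, Set.mem_ofPred_eq, List.head?_cons,
        Option.some.injEq, List.length_cons, Nat.add_right_cancel_iff, Set.mem_image,
        List.cons.injEq, next_empty, Set.mem_univ, Set.mem_empty_iff_false]
      aesop
  rw [growth, this, Set.ncard_image_of_injective _ List.cons_injective, ncard_setOf_readable,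
    Set.indicator_univ]

theorem growth_GeoEnd_succ [Fintype V] (x : V) (n : ℕ) :
    growth (GeoEnd Γ x) (n + 1) = (transfer Γ Finset.univ ^ n) (avoiding x) ∅ := by
  have : {w | w ∈ GeoEnd Γ x ∧ w.length = n + 1} =
      (· ++ [x]) '' {w | Readable Γ ∅ w ∧ state Γ ∅ w ∈ {D | x ∉ D} ∧ w.length = n} := by
    ext w
    induction w using List.reverseRecOn with
    | nil => simp
    | append_singleton w s =>
      simp only [GeoEnd, mem_Geo_iff_readable, readable_append, readable_singleton,
        Set.mem_ofPred_eq, Set.mem_image, List.append_singleton_inj]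
      aesop
  rw [growth, this, Set.ncard_image_of_injective _ (List.append_left_injective _),
    ncard_setOf_readable, avoiding]

theorem growth_GeoEnd (x : V) (n : ℕ) : growth (GeoEnd Γ x) n = growth (GeoStart Γ x) n := by
  have : {w | w ∈ GeoEnd Γ x ∧ w.length = n} =
      List.reverse '' {w | w ∈ GeoStart Γ x ∧ w.length = n} := by
    ext w
    rw [Set.image_eq_preimage_of_inverse List.reverse_reverse List.reverse_reverse]
    simp [GeoEnd, GeoStart, Geo]
  rw [growth, this, Set.ncard_image_of_injective _ List.reverse_injective, growth]

theorem transfer_pow_avoiding_empty [Fintype V] (x : V) (n : ℕ) :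
    (transfer Γ Finset.univ ^ n) (avoiding x) ∅ = (transfer Γ Finset.univ ^ n) 1 {x} := by
  rw [← growth_GeoEnd_succ, growth_GeoEnd, growth_GeoStart_succ]

end Transfer

/-! ### Splitting words at the first letter outside a set -/

section Split

variable {V : Type*} {Γ : SimpleGraph V}

/-- The transfer operator of the words of length `m` that are empty or begin with a letter of `Y`:
the last part of a word split after its longest prefix outside `Y`. -/
def outer [Fintype V] (Γ : SimpleGraph V) (Y : Finset V) : ℕ → Module.End ℕ (Set V → ℕ)
  | 0 => 1
  | m + 1 => transfer Γ Y * transfer Γ Finset.univ ^ m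

theorem transfer_univ_eq_add [Fintype V] {X Y : Finset V} (h : IsCompl X Y) :
    transfer Γ Finset.univ = transfer Γ X + transfer Γ Y := by
  classical
  ext φ D
  exact (h.sum_add_sum _).symm

theorem transfer_univ_pow [Fintype V] {X Y : Finset V} (h : IsCompl X Y) (n : ℕ) :
    transfer Γ Finset.univ ^ n =
      ∑ k ∈ Finset.range (n + 1), transfer Γ X ^ k * outer Γ Y (n - k) := by
  induction n with
  | zero => simp [outer]
  | succ n ih =>
    rw [pow_succ', Finset.sum_range_succ']
    nth_rewrite 1 [transfer_univ_eq_add h]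
    rw [add_mul, pow_zero, one_mul, Nat.sub_zero, outer, ih, Finset.mul_sum]
    simp only [pow_succ', mul_assoc, Nat.add_sub_add_right]

theorem antitone_outer [Fintype V] (Y : Finset V) (m : ℕ) {φ : Set V → ℕ} (hφ : Antitone φ) :
    Antitone (outer Γ Y m φ) := by
  cases m with
  | zero => exact hφ
  | succ m => exact antitone_transfer Y (antitone_transfer_pow _ m hφ)

end Split

/-! ### Coalescences -/

section Embedding

variable {V W : Type*} {Γ : SimpleGraph V} {Δ : SimpleGraph W}

theorem preimage_next (f : Γ ↪g Δ) (C : Set W) (s : V) :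
    f ⁻¹' next Δ C (f s) = next Γ (f ⁻¹' C) s := by
  ext t
  simp only [Set.mem_preimage, mem_next, f.injective.eq_iff, f.map_adj_iff]

theorem transfer_map (f : Γ ↪g Δ) (X : Finset V) (ψ : Set V → ℕ) (C : Set W) :
    transfer Δ (X.map f.toEmbedding) (fun C => ψ (f ⁻¹' C)) C = transfer Γ X ψ (f ⁻¹' C) := by
  rw [transfer_apply, transfer_apply, Finset.sum_map]
  simp only [Set.mem_preimage, ← preimage_next]
  rfl

end Embedding

section Coalescence

variable {V W : Type*} (τ : SimpleGraph V) (a : V) (σ : SimpleGraph W) (b : W)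

/-- The first rooted graph as an induced subgraph of the coalescence. -/
def coalescence.inl : τ ↪g coalescence τ a σ b where
  toFun := Sum.inl
  inj' := Sum.inl_injective
  map_rel_iff' := Iff.rfl

open Classical in
/-- The second rooted graph as an induced subgraph of the coalescence. -/
def coalescence.inr : σ ↪g coalescence τ a σ b where
  toFun w := if h : w = b then .inl a else .inr ⟨w, h⟩
  inj' w w' h := by
    dsimp only at h
    split_ifs at h with hw hw' hw'
    · rw [hw, hw']
    · simpa using h
  map_rel_iff' {w w'} := by
    by_cases hw : w = b <;> by_cases hw' : w' = b <;> simp [hw, hw', coalescence, σ.adj_comm]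

open coalescence

variable {τ a σ b}

theorem inr_root : inr τ a σ b b = inl τ a σ b a := dif_pos rfl

theorem inr_of_ne {w : W} (h : w ≠ b) : inr τ a σ b w = Sum.inr ⟨w, h⟩ := dif_neg h

theorem inl_eq_inr_iff {x : V} {w : W} : inl τ a σ b x = inr τ a σ b w ↔ x = a ∧ w = b := by
  by_cases hw : w = b
  · rw [hw, inr_root, (inl τ a σ b).injective.eq_iff, and_iff_left rfl]
  · simp [inr_of_ne hw, hw, inl]

theorem next_inl (C : Set (V ⊕ {w : W // w ≠ b})) {x : V} (hx : x ≠ a) :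
    next (coalescence τ a σ b) C (inl τ a σ b x) =
      inl τ a σ b '' next τ (inl τ a σ b ⁻¹' C) x := by
  rw [← preimage_next, Set.image_preimage_eq_of_subset]
  rintro (y | w) hy
  · exact ⟨y, rfl⟩
  · rcases hy with hy | ⟨-, hxa, -⟩
    · cases hy
    · exact absurd hxa hx

theorem next_inr_subset (C : Set (V ⊕ {w : W // w ≠ b})) {w : W} (hw : w ≠ b) :
    next (coalescence τ a σ b) C (inr τ a σ b w) ⊆ Set.range (inr τ a σ b) := by
  rintro (y | v) hy
  · rw [inr_of_ne hw] at hy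
    rcases hy with hy | ⟨-, rfl, -⟩
    · cases hy
    · exact ⟨b, inr_root⟩
  · exact ⟨v, inr_of_ne v.2⟩

theorem next_inr_subset_of_subset {C : Set (V ⊕ {w : W // w ≠ b})}
    (hC : C ⊆ Set.range (inr τ a σ b)) (w : W) :
    next (coalescence τ a σ b) C (inr τ a σ b w) ⊆ Set.range (inr τ a σ b) :=
  Set.insert_subset ⟨w, rfl⟩ (Set.inter_subset_left.trans hC)

theorem preimage_inl_of_subset {C : Set (V ⊕ {w : W // w ≠ b})}
    (hC : C ⊆ Set.range (inr τ a σ b)) :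
    inl τ a σ b ⁻¹' C = {y | y = a ∧ b ∈ inr τ a σ b ⁻¹' C} := by
  ext y
  constructor
  · intro hy
    obtain ⟨w, hw⟩ := hC hy
    obtain ⟨rfl, rfl⟩ := inl_eq_inr_iff.1 hw.symm
    exact ⟨rfl, by rwa [Set.mem_preimage, hw]⟩
  · rintro ⟨rfl, hb⟩
    rwa [Set.mem_preimage, inr_root] at hb

theorem preimage_inr_image_inl (D : Set V) :
    inr τ a σ b ⁻¹' (inl τ a σ b '' D) = {w | w = b ∧ a ∈ D} := by
  ext w
  simp only [Set.mem_preimage, Set.mem_image, inl_eq_inr_iff, Set.mem_ofPred_eq]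
  aesop

end Coalescence

open coalescence

section Letters

variable {V W : Type*}

open Classical in
/-- The letters of the coalescence that come from the first graph, without the common root. -/
def leftLetters [Fintype V] (τ : SimpleGraph V) (a : V) (σ : SimpleGraph W) (b : W) :
    Finset (V ⊕ {w : W // w ≠ b}) :=
  (Finset.univ.erase a).map (inl τ a σ b).toEmbedding

/-- The letters of the coalescence that come from the second graph, with the common root. -/
def rightLetters [Fintype W] (τ : SimpleGraph V) (a : V) (σ : SimpleGraph W) (b : W) :
    Finset (V ⊕ {w : W // w ≠ b}) :=
  Finset.univ.map (inr τ a σ b).toEmbedding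

variable {τ : SimpleGraph V} {a : V} {σ : SimpleGraph W} {b : W}

theorem mem_leftLetters [Fintype V] {s : V ⊕ {w : W // w ≠ b}} :
    s ∈ leftLetters τ a σ b ↔ ∃ x ≠ a, inl τ a σ b x = s := by
  simp only [leftLetters, Finset.mem_map, Finset.mem_erase, Finset.mem_univ, and_true]
  rfl

theorem mem_rightLetters [Fintype W] {s : V ⊕ {w : W // w ≠ b}} :
    s ∈ rightLetters τ a σ b ↔ ∃ w, inr τ a σ b w = s := by
  simp [rightLetters]

open Classical in
theorem isCompl_letters [Fintype V] [Fintype W] :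
    IsCompl (rightLetters τ a σ b) (leftLetters τ a σ b) := by
  rw [isCompl_iff, Finset.disjoint_left, Finset.codisjoint_left]
  simp only [mem_leftLetters, mem_rightLetters]
  constructor
  · rintro _ ⟨w, rfl⟩ ⟨x, hx, hxw⟩
    exact hx (inl_eq_inr_iff.1 hxw).1
  · rintro (x | w) hs
    · refine ⟨x, ?_, rfl⟩
      rintro rfl
      exact hs ⟨b, inr_root⟩
    · exact absurd ⟨w, inr_of_ne w.2⟩ hs

open Classical in
theorem transfer_leftLetters [Fintype V] (φ : Set (V ⊕ {w : W // w ≠ b}) → ℕ)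
    (C : Set (V ⊕ {w : W // w ≠ b})) :
    transfer (coalescence τ a σ b) (leftLetters τ a σ b) φ C =
      transfer τ (Finset.univ.erase a) (fun D => φ (inl τ a σ b '' D)) (inl τ a σ b ⁻¹' C) := by
  rw [transfer_apply, transfer_apply, leftLetters, Finset.sum_map]
  refine Finset.sum_congr rfl fun x hx => ?_
  rw [← next_inl C (Finset.ne_of_mem_erase hx)]
  rfl

section RightLetters

variable [Fintype W] {φ : Set (V ⊕ {w : W // w ≠ b}) → ℕ} {ψ : Set W → ℕ}

theorem transfer_rightLetters {C : Set (V ⊕ {w : W // w ≠ b})}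
    (h : ∀ w, inr τ a σ b w ∉ C →
      φ (next (coalescence τ a σ b) C (inr τ a σ b w)) =
        ψ (inr τ a σ b ⁻¹' next (coalescence τ a σ b) C (inr τ a σ b w))) :
    transfer (coalescence τ a σ b) (rightLetters τ a σ b) φ C =
      transfer σ Finset.univ ψ (inr τ a σ b ⁻¹' C) := by
  rw [← transfer_map, ← rightLetters]
  refine transfer_congr fun s hs hC => ?_
  obtain ⟨w, rfl⟩ := mem_rightLetters.1 hs
  exact h w hC

theorem transfer_rightLetters_pow_of_subset
    (h : ∀ C ⊆ Set.range (inr τ a σ b), φ C = ψ (inr τ a σ b ⁻¹' C))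
    (k : ℕ) {C : Set (V ⊕ {w : W // w ≠ b})}
    (hC : C ⊆ Set.range (inr τ a σ b)) :
    (transfer (coalescence τ a σ b) (rightLetters τ a σ b) ^ k) φ C =
      (transfer σ Finset.univ ^ k) ψ (inr τ a σ b ⁻¹' C) := by
  induction k generalizing C with
  | zero => exact h C hC
  | succ k ih =>
    rw [transfer_pow_succ_apply, transfer_pow_succ_apply]
    exact transfer_rightLetters fun w _ => ih (next_inr_subset_of_subset hC w)

theorem transfer_rightLetters_pow_succ
    (h : ∀ C ⊆ Set.range (inr τ a σ b), φ C = ψ (inr τ a σ b ⁻¹' C))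
    (k : ℕ) {C : Set (V ⊕ {w : W // w ≠ b})}
    (hC : inr τ a σ b b ∈ C) :
    (transfer (coalescence τ a σ b) (rightLetters τ a σ b) ^ (k + 1)) φ C =
      (transfer σ Finset.univ ^ (k + 1)) ψ (inr τ a σ b ⁻¹' C) := by
  rw [transfer_pow_succ_apply, transfer_pow_succ_apply]
  refine transfer_rightLetters fun w hw => transfer_rightLetters_pow_of_subset h k ?_
  exact next_inr_subset C fun hwb => hw (hwb ▸ hC)

theorem transfer_rightLetters_pow_add_two
    (h : ∀ C ⊆ Set.range (inr τ a σ b), φ C = ψ (inr τ a σ b ⁻¹' C))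
    (k : ℕ) (C : Set (V ⊕ {w : W // w ≠ b})) :
    (transfer (coalescence τ a σ b) (rightLetters τ a σ b) ^ (k + 2)) φ C =
      (transfer σ Finset.univ ^ (k + 2)) ψ (inr τ a σ b ⁻¹' C) := by
  rw [transfer_pow_succ_apply _ (k + 1), transfer_pow_succ_apply _ (k + 1)]
  refine transfer_rightLetters fun w _ => ?_
  rcases eq_or_ne w b with rfl | hwb
  · exact transfer_rightLetters_pow_succ h k (Set.mem_insert _ _)
  · exact transfer_rightLetters_pow_of_subset h _ (next_inr_subset C hwb)

end RightLetters

end Letters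

section RootWeight

variable {W : Type*} {b : W}

open Classical in
/-- The weight `y` on the states that contain `b`, and `x` on the other ones. -/
def rootWeight (b : W) (x y : ℕ) : Set W → ℕ := fun E => if b ∈ E then y else x

theorem rootWeight_mono {x x' y y' : ℕ} (hx : x ≤ x') (hy : y ≤ y') :
    rootWeight b x y ≤ rootWeight b x' y' := fun E => by
  rw [rootWeight, rootWeight]
  split_ifs
  exacts [hy, hx]

theorem rootWeight_eq {x y : ℕ} (h : y ≤ x) :
    rootWeight b x y = y • (1 : Set W → ℕ) + (x - y) • avoiding b := by
  funext E
  by_cases hb : b ∈ E <;> simp [rootWeight, avoiding, hb, h]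

theorem transfer_pow_rootWeight [Fintype W] (σ : SimpleGraph W) {x y : ℕ} (h : y ≤ x) (k : ℕ)
    (E : Set W) :
    (transfer σ Finset.univ ^ k) (rootWeight b x y) E =
      y * (transfer σ Finset.univ ^ k) 1 E +
        (x - y) * (transfer σ Finset.univ ^ k) (avoiding b) E := by
  simp only [rootWeight_eq h, map_add, map_nsmul, Pi.add_apply, Pi.smul_apply, smul_eq_mul]

end RootWeight

section CountAfter

variable {V W : Type*} [Fintype V] [Fintype W]

open Classical in
/-- The number of words of length `n` over the coalescence that can be read after `D`, a state of
the first graph. -/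
def countAfter (τ : SimpleGraph V) (a : V) (σ : SimpleGraph W) (b : W) (n : ℕ) (D : Set V) : ℕ :=
  (transfer (coalescence τ a σ b) Finset.univ ^ n) 1 (inl τ a σ b '' D)

open Classical in
/-- The number of words of length `m` over the coalescence that can be read after `D`, a state of
the first graph, and that do not begin with a letter of the second graph. -/
def countOuter (τ : SimpleGraph V) (a : V) (σ : SimpleGraph W) (b : W) (m : ℕ) (D : Set V) : ℕ :=
  outer (coalescence τ a σ b) (leftLetters τ a σ b) m 1 (inl τ a σ b '' D)

open Classical in
/-- The contribution to `countAfter` of the words whose longest prefix over the second graph has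
length `k` and is followed by `m` letters. -/
def splitTerm (τ : SimpleGraph V) (a : V) (σ : SimpleGraph W) (b : W) (k m : ℕ) (D : Set V) : ℕ :=
  (transfer (coalescence τ a σ b) (rightLetters τ a σ b) ^ k)
    (outer (coalescence τ a σ b) (leftLetters τ a σ b) m 1) (inl τ a σ b '' D)

variable {τ : SimpleGraph V} {a : V} {σ : SimpleGraph W} {b : W}

theorem countAfter_eq_sum (n : ℕ) (D : Set V) :
    countAfter τ a σ b n D = ∑ k ∈ Finset.range (n + 1), splitTerm τ a σ b k (n - k) D := by
  classical
  simp only [countAfter, transfer_univ_pow (isCompl_letters (τ := τ) (a := a) (σ := σ) (b := b)),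
    LinearMap.sum_apply, Finset.sum_apply, Module.End.mul_apply, splitTerm]

theorem growth_Geo_coalescence (n : ℕ) :
    growth (Geo (coalescence τ a σ b)) n = countAfter τ a σ b n ∅ := by
  classical
  rw [growth_Geo, countAfter, Set.image_empty]

open Classical in
theorem antitone_countOuter (m : ℕ) : Antitone (countOuter τ a σ b m) := fun _ _ h =>
  antitone_outer (φ := 1) _ m antitone_const (Set.image_mono h)

open Classical in
theorem countOuter_succ (m : ℕ) (D : Set V) :
    countOuter τ a σ b (m + 1) D =
      transfer τ (Finset.univ.erase a) (countAfter τ a σ b m) D := by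
  rw [countOuter, outer, Module.End.mul_apply, transfer_leftLetters,
    Set.preimage_image_eq _ (inl τ a σ b).injective]
  rfl

open Classical in
theorem outer_eq_countOuter (m : ℕ) (C : Set (V ⊕ {w : W // w ≠ b})) :
    outer (coalescence τ a σ b) (leftLetters τ a σ b) m 1 C =
      countOuter τ a σ b m (inl τ a σ b ⁻¹' C) := by
  cases m with
  | zero => rfl
  | succ m =>
    rw [countOuter_succ, outer, Module.End.mul_apply, transfer_leftLetters]
    rfl

open Classical in
theorem outer_eq_rootWeight (m : ℕ) {C : Set (V ⊕ {w : W // w ≠ b})}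
    (hC : C ⊆ Set.range (inr τ a σ b)) :
    outer (coalescence τ a σ b) (leftLetters τ a σ b) m 1 C =
      rootWeight b (countOuter τ a σ b m ∅) (countOuter τ a σ b m {a}) (inr τ a σ b ⁻¹' C) := by
  rw [outer_eq_countOuter, preimage_inl_of_subset hC, rootWeight]
  split_ifs with hb <;> simp [hb]

theorem splitTerm_zero (m : ℕ) (D : Set V) :
    splitTerm τ a σ b 0 m D = countOuter τ a σ b m D := rfl

theorem splitTerm_one {D : Set V} (hD : a ∉ D) (m : ℕ) :
    splitTerm τ a σ b 1 m D =
      (Fintype.card W - 1) * countOuter τ a σ b m ∅ + countOuter τ a σ b m (next τ D a) := by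
  classical
  have fresh (w : W) : inr τ a σ b w ∉ inl τ a σ b '' D := by
    rintro ⟨x, hx, hxw⟩
    exact hD ((inl_eq_inr_iff.1 hxw).1 ▸ hx)
  have outer_next {w : W} (hw : w ∈ Finset.univ.erase b) :
      countOuter τ a σ b m (inl τ a σ b ⁻¹' next (coalescence τ a σ b) (inl τ a σ b '' D)
        (inr τ a σ b w)) = countOuter τ a σ b m ∅ := by
    have hwb := Finset.ne_of_mem_erase hw
    rw [preimage_inl_of_subset (next_inr_subset _ hwb), preimage_next, preimage_inr_image_inl]
    simp [mem_next, hwb.symm, hD]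
  rw [splitTerm, pow_one, transfer_apply, rightLetters, Finset.sum_map]
  simp only [RelEmbedding.coe_toEmbedding, fresh, if_false, outer_eq_countOuter]
  rw [← Finset.sum_erase_add _ _ (Finset.mem_univ b), Finset.sum_congr rfl fun w => outer_next,
    Finset.sum_const, Finset.card_erase_of_mem (Finset.mem_univ b), Finset.card_univ,
    smul_eq_mul, inr_root, preimage_next, Set.preimage_image_eq _ (inl τ a σ b).injective]

theorem splitTerm_succ_of_mem {D : Set V} (hD : a ∈ D) (k m : ℕ) :
    splitTerm τ a σ b (k + 1) m D =
      (transfer σ Finset.univ ^ (k + 1))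
        (rootWeight b (countOuter τ a σ b m ∅) (countOuter τ a σ b m {a})) {w | w = b ∧ a ∈ D} := by
  rw [splitTerm, ← preimage_inr_image_inl (τ := τ) (σ := σ)]
  refine transfer_rightLetters_pow_succ (fun C => outer_eq_rootWeight m) k ?_
  rw [inr_root]
  exact Set.mem_image_of_mem _ hD

theorem splitTerm_add_two (k m : ℕ) (D : Set V) :
    splitTerm τ a σ b (k + 2) m D =
      (transfer σ Finset.univ ^ (k + 2))
        (rootWeight b (countOuter τ a σ b m ∅) (countOuter τ a σ b m {a})) {w | w = b ∧ a ∈ D} := by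
  rw [splitTerm, ← preimage_inr_image_inl (τ := τ) (σ := σ)]
  exact transfer_rightLetters_pow_add_two (fun C => outer_eq_rootWeight m) k _

end CountAfter

/-! ### Comparison of coalescences with two graphs -/

theorem countOuter_two_lt {V W : Type*} [Fintype V] [Fintype W] {τ : SimpleGraph V} {a x : V}
    (hx : τ.Adj a x) (σ : SimpleGraph W) (b : W) :
    countOuter τ a σ b 2 {a} < countOuter τ a σ b 2 ∅ := by
  classical
  have next_subset (y : V) : next τ ∅ y ⊆ next τ {a} y := next_mono y (Set.empty_subset {a})
  have anti : StrictAnti (countAfter τ a σ b 1) := fun D E h =>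
    strictAnti_transfer_univ_one (((inl τ a σ b).injective.image_strictMono) h)
  rw [countOuter_succ, countOuter_succ, transfer_apply, transfer_apply]
  refine Finset.sum_lt_sum (fun y hy => ?_) ⟨x, Finset.mem_erase.2 ⟨hx.ne', Finset.mem_univ x⟩, ?_⟩
  · simpa [Finset.ne_of_mem_erase hy] using anti.antitone (next_subset y)
  · have hne : next τ ∅ x ⊂ next τ {a} x := by
      refine (Set.ssubset_iff_of_subset (next_subset x)).2 ⟨a, Or.inr ⟨rfl, hx.symm⟩, ?_⟩
      simp [next_empty, hx.ne]
    simpa [hx.ne'] using anti hne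

section Comparison

variable {W₁ W₂ : Type*} [Fintype W₁] [Fintype W₂]

theorem countOuter_le_of_countAfter_le {V : Type*} [Fintype V] {τ : SimpleGraph V} {a : V}
    {σ₁ : SimpleGraph W₁} {b₁ : W₁} {σ₂ : SimpleGraph W₂} {b₂ : W₂} {m : ℕ}
    (h : ∀ n < m, countAfter τ a σ₁ b₁ n ≤ countAfter τ a σ₂ b₂ n) :
    countOuter τ a σ₁ b₁ m ≤ countOuter τ a σ₂ b₂ m := by
  cases m with
  | zero => exact le_rfl
  | succ m =>
    intro D
    rw [countOuter_succ, countOuter_succ]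
    exact transfer_mono _ (h m m.lt_succ_self) D

/-- Up to length `K`, the rooted graph `(σ₂, b₂)` has at least as many geodesic words, geodesic
words starting with the root, and geodesic words starting and ending with the root as `(σ₁, b₁)`.
The starting root is not counted in the length; `avoiding` accounts for the final one. -/
structure Dominated (σ₁ : SimpleGraph W₁) (b₁ : W₁) (σ₂ : SimpleGraph W₂) (b₂ : W₂) (K : ℕ) :
    Prop where
  all_empty : ∀ k ≤ K,
    (transfer σ₁ Finset.univ ^ k) 1 ∅ ≤ (transfer σ₂ Finset.univ ^ k) 1 ∅
  all_root : ∀ k ≤ K,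
    (transfer σ₁ Finset.univ ^ k) 1 {b₁} ≤ (transfer σ₂ Finset.univ ^ k) 1 {b₂}
  avoiding_root : ∀ k ≤ K,
    (transfer σ₁ Finset.univ ^ k) (avoiding b₁) {b₁} ≤
      (transfer σ₂ Finset.univ ^ k) (avoiding b₂) {b₂}

namespace Dominated

variable {σ₁ : SimpleGraph W₁} {b₁ : W₁} {σ₂ : SimpleGraph W₂} {b₂ : W₂} {K : ℕ}

theorem card_le (H : Dominated σ₁ b₁ σ₂ b₂ K) (hK : 1 ≤ K) :
    Fintype.card W₁ ≤ Fintype.card W₂ := by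
  simpa [transfer_apply] using H.all_empty 1 hK

theorem one_le (H : Dominated σ₁ b₁ σ₂ b₂ K) {k : ℕ} (hk : k ≤ K) (p : Prop) :
    (transfer σ₁ Finset.univ ^ k) 1 {w | w = b₁ ∧ p} ≤
      (transfer σ₂ Finset.univ ^ k) 1 {w | w = b₂ ∧ p} := by
  by_cases hp : p
  · simpa [hp] using H.all_root k hk
  · simpa [hp] using H.all_empty k hk

theorem avoiding_le (H : Dominated σ₁ b₁ σ₂ b₂ K) {k : ℕ} (hk : k ≤ K) (p : Prop) :
    (transfer σ₁ Finset.univ ^ k) (avoiding b₁) {w | w = b₁ ∧ p} ≤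
      (transfer σ₂ Finset.univ ^ k) (avoiding b₂) {w | w = b₂ ∧ p} := by
  by_cases hp : p
  · simpa [hp] using H.avoiding_root k hk
  · simpa [hp, transfer_pow_avoiding_empty] using H.all_root k hk

theorem rootWeight_le (H : Dominated σ₁ b₁ σ₂ b₂ K) {k : ℕ} (hk : k ≤ K) (p : Prop)
    {x₁ x₂ y₁ y₂ : ℕ} (hx : x₁ ≤ x₂) (hy : y₁ ≤ y₂) (hyx : y₂ ≤ x₂) :
    (transfer σ₁ Finset.univ ^ k) (rootWeight b₁ x₁ y₁) {w | w = b₁ ∧ p} ≤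
      (transfer σ₂ Finset.univ ^ k) (rootWeight b₂ x₂ y₂) {w | w = b₂ ∧ p} := by
  refine (transfer_pow_mono _ k (rootWeight_mono hx hy) _).trans ?_
  rw [transfer_pow_rootWeight _ hyx, transfer_pow_rootWeight _ hyx]
  gcongr
  exacts [H.one_le hk p, H.avoiding_le hk p]

theorem rootWeight_empty_lt (H : Dominated σ₁ b₁ σ₂ b₂ K) {k : ℕ} (hk : k ≤ K)
    (hlt : (transfer σ₁ Finset.univ ^ k) 1 {b₁} < (transfer σ₂ Finset.univ ^ k) 1 {b₂})
    {x₁ x₂ y₁ y₂ : ℕ} (hx : x₁ ≤ x₂) (hy : y₁ ≤ y₂) (hyx : y₂ < x₂) :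
    (transfer σ₁ Finset.univ ^ k) (rootWeight b₁ x₁ y₁) ∅ <
      (transfer σ₂ Finset.univ ^ k) (rootWeight b₂ x₂ y₂) ∅ := by
  refine (transfer_pow_mono _ k (rootWeight_mono hx hy) _).trans_lt ?_
  rw [transfer_pow_rootWeight _ hyx.le, transfer_pow_rootWeight _ hyx.le,
    transfer_pow_avoiding_empty, transfer_pow_avoiding_empty]
  exact add_lt_add_of_le_of_lt (Nat.mul_le_mul_left _ (H.all_empty k hk))
    (Nat.mul_lt_mul_of_pos_left hlt (Nat.sub_pos_of_lt hyx))

variable {V : Type*} [Fintype V] {τ : SimpleGraph V} {a : V}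

theorem splitTerm_le (H : Dominated σ₁ b₁ σ₂ b₂ K) {k m : ℕ} (hk : k ≤ K)
    (hm : countOuter τ a σ₁ b₁ m ≤ countOuter τ a σ₂ b₂ m) (D : Set V) :
    splitTerm τ a σ₁ b₁ k m D ≤ splitTerm τ a σ₂ b₂ k m D := by
  have hweight := H.rootWeight_le hk (a ∈ D) (hm ∅) (hm {a})
    (antitone_countOuter m (Set.empty_subset {a}))
  match k with
  | 0 => simpa only [splitTerm_zero] using hm D
  | 1 =>
    by_cases ha : a ∈ D
    · rwa [splitTerm_succ_of_mem ha, splitTerm_succ_of_mem ha]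
    · rw [splitTerm_one ha, splitTerm_one ha]
      gcongr
      exacts [H.card_le hk, hm ∅, hm _]
  | k + 2 => rwa [splitTerm_add_two, splitTerm_add_two]

theorem countAfter_le (H : Dominated σ₁ b₁ σ₂ b₂ K) {n : ℕ} (hn : n ≤ K) :
    countAfter τ a σ₁ b₁ n ≤ countAfter τ a σ₂ b₂ n := by
  induction n using Nat.strong_induction_on with
  | _ n ih =>
    intro D
    rw [countAfter_eq_sum, countAfter_eq_sum]
    refine Finset.sum_le_sum fun k hk => ?_
    have hkn : k ≤ n := Finset.mem_range_succ_iff.1 hk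
    refine H.splitTerm_le (hkn.trans hn) (countOuter_le_of_countAfter_le fun i hi => ?_) D
    exact ih i (by lia) (by lia)

end Dominated

/-- Strictness comes from the words whose longest prefix over the second graph is followed by two
letters: whether that prefix can end with the root makes no difference for the first of them, but
does for the second. -/
theorem Dominated.growth_lt {V W₁ W₂ : Type*} [Finite V] [Fintype W₁] [Fintype W₂]
    {σ₁ : SimpleGraph W₁} {b₁ : W₁} {σ₂ : SimpleGraph W₂} {b₂ : W₂} {K : ℕ}
    (H : Dominated σ₁ b₁ σ₂ b₂ K) {k : ℕ} (hk : k + 4 ≤ K)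
    (hlt : (transfer σ₁ Finset.univ ^ (k + 2)) 1 {b₁} < (transfer σ₂ Finset.univ ^ (k + 2)) 1 {b₂})
    {τ : SimpleGraph V} {a x : V} (hx : τ.Adj a x) :
    growth (Geo (coalescence τ a σ₁ b₁)) (k + 4) <
      growth (Geo (coalescence τ a σ₂ b₂)) (k + 4) := by
  have := Fintype.ofFinite V
  have outer_le {m : ℕ} (hm : m ≤ K) : countOuter τ a σ₁ b₁ m ≤ countOuter τ a σ₂ b₂ m :=
    countOuter_le_of_countAfter_le fun n hn => H.countAfter_le (hn.le.trans hm)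
  rw [growth_Geo_coalescence, growth_Geo_coalescence, countAfter_eq_sum, countAfter_eq_sum]
  refine Finset.sum_lt_sum (fun j hj => ?_) ⟨k + 2, Finset.mem_range.2 (by lia), ?_⟩
  · rw [Finset.mem_range] at hj
    exact H.splitTerm_le (by lia) (outer_le (by lia)) ∅
  · rw [show k + 4 - (k + 2) = 2 by lia, splitTerm_add_two, splitTerm_add_two]
    simp only [Set.mem_empty_iff_false, and_false, Set.ofPred_false]
    exact H.rootWeight_empty_lt (by lia) hlt (outer_le (by lia) ∅) (outer_le (by lia) {a})
      (countOuter_two_lt hx σ₂ b₂)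

end Comparison

/-! ### Evaluation on triangle-free graphs -/

theorem transfer_pow_succ_empty {V : Type*} [Fintype V] (Γ : SimpleGraph V) (φ : Set V → ℕ)
    (k : ℕ) :
    (transfer Γ Finset.univ ^ (k + 1)) φ ∅ = ∑ s, (transfer Γ Finset.univ ^ k) φ {s} := by
  simp [transfer_pow_succ_apply, transfer_apply, next_empty]

section PairStep

variable {V : Type*} {Γ : SimpleGraph V} [DecidableRel Γ.Adj]

theorem next_pair (hΓ : Γ.CliqueFree 3) {x y : V} (hxy : x = y ∨ Γ.Adj x y) (s : V) :
    next Γ {x, y} s = if Γ.Adj s x then {s, x} else if Γ.Adj s y then {s, y} else {s} := by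
  classical
  have no_triangle (hsx : Γ.Adj s x) (hsy : Γ.Adj s y) : x = y :=
    hxy.resolve_right fun h => hΓ {s, x, y} (SimpleGraph.is3Clique_triple_iff.2 ⟨hsx, hsy, h⟩)
  ext t
  simp only [mem_next, Set.mem_insert_iff, Set.mem_singleton_iff]
  split_ifs <;> grind

variable [Fintype V] [DecidableEq V]

/-- The transfer operator of a triangle-free graph, on functions of the elements of a state: the
states reached by nonempty words are then `{x, y}` with `x = y` or `x` and `y` adjacent. Unlike
`transfer`, it can be evaluated. -/
def pairStep (Γ : SimpleGraph V) [DecidableRel Γ.Adj] (f : V → V → ℕ) (x y : V) : ℕ :=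
  ∑ s, if s = x ∨ s = y then 0
    else if Γ.Adj s x then f s x else if Γ.Adj s y then f s y else f s s

theorem transfer_pow_pair (hΓ : Γ.CliqueFree 3) (φ : Set V → ℕ) (k : ℕ) {x y : V}
    (hxy : x = y ∨ Γ.Adj x y) :
    (transfer Γ Finset.univ ^ k) φ {x, y} = (pairStep Γ)^[k] (fun x y => φ {x, y}) x y := by
  induction k generalizing x y with
  | zero => rfl
  | succ k ih =>
    rw [transfer_pow_succ_apply, transfer_apply, Function.iterate_succ_apply', pairStep]
    refine Finset.sum_congr rfl fun s _ => ?_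
    rw [next_pair hΓ hxy]
    simp only [Set.mem_insert_iff, Set.mem_singleton_iff]
    split_ifs with _ hsx hsy
    exacts [rfl, ih (Or.inr hsx), ih (Or.inr hsy), Set.pair_eq_singleton s ▸ ih (Or.inl rfl)]

theorem transfer_pow_one_singleton (hΓ : Γ.CliqueFree 3) (k : ℕ) (x : V) :
    (transfer Γ Finset.univ ^ k) 1 {x} = (pairStep Γ)^[k] (fun _ _ => 1) x x := by
  rw [← Set.pair_eq_singleton, transfer_pow_pair hΓ _ k (Or.inl rfl)]
  rfl

theorem transfer_pow_avoiding_singleton (hΓ : Γ.CliqueFree 3) (k : ℕ) (x : V) :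
    (transfer Γ Finset.univ ^ k) (avoiding x) {x} =
      (pairStep Γ)^[k] (fun y z => if x = y ∨ x = z then 0 else 1) x x := by
  have avoiding_pair :
      (fun y z => avoiding x {y, z}) = fun y z => if x = y ∨ x = z then 0 else 1 := by
    funext y z
    by_cases h : x = y ∨ x = z <;> simp [avoiding, h]
  rw [← Set.pair_eq_singleton, transfer_pow_pair hΓ _ k (Or.inl rfl), avoiding_pair]

end PairStep

theorem dominated_of_pairStep_le {V W : Type*} [Fintype V] [DecidableEq V] [Fintype W]
    [DecidableEq W] {Γ : SimpleGraph V} {Δ : SimpleGraph W} [DecidableRel Γ.Adj]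
    [DecidableRel Δ.Adj] (hΓ : Γ.CliqueFree 3) (hΔ : Δ.CliqueFree 3) {x : V} {y : W} {K : ℕ}
    (hsum : ∀ k < K, ∑ s, (pairStep Γ)^[k] (fun _ _ => 1) s s ≤
      ∑ s, (pairStep Δ)^[k] (fun _ _ => 1) s s)
    (hone : ∀ k ≤ K, (pairStep Γ)^[k] (fun _ _ => 1) x x ≤ (pairStep Δ)^[k] (fun _ _ => 1) y y)
    (havoiding : ∀ k ≤ K, (pairStep Γ)^[k] (fun s t => if x = s ∨ x = t then 0 else 1) x x ≤
      (pairStep Δ)^[k] (fun s t => if y = s ∨ y = t then 0 else 1) y y) :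
    Dominated Γ x Δ y K where
  all_empty k hk := by
    cases k with
    | zero => simp
    | succ k =>
      simpa only [transfer_pow_succ_empty, transfer_pow_one_singleton, hΓ, hΔ] using hsum k hk
  all_root k hk := by simpa only [transfer_pow_one_singleton, hΓ, hΔ] using hone k hk
  avoiding_root k hk := by
    simpa only [transfer_pow_avoiding_singleton, hΓ, hΔ] using havoiding k hk

/-! ### The trees `S₁`, `S₂` and their subdivisions -/

section Trees

instance (n : ℕ) (l : List (Fin n × Fin n)) : DecidableRel (ofEdges n l).Adj :=
  inferInstanceAs (DecidableRel (SimpleGraph.fromRel _).Adj)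

instance : DecidableRel S₁.Adj := inferInstanceAs (DecidableRel (ofEdges _ _).Adj)

instance : DecidableRel S₂.Adj := inferInstanceAs (DecidableRel (ofEdges _ _).Adj)

instance : DecidableRel S₁ext.Adj := inferInstanceAs (DecidableRel (ofEdges _ _).Adj)

instance : DecidableRel S₂ext.Adj := inferInstanceAs (DecidableRel (ofEdges _ _).Adj)

theorem cliqueFree_of_coloring {V : Type*} {Γ : SimpleGraph V} (c : V → Bool)
    (hc : ∀ x y, Γ.Adj x y → c x ≠ c y) : Γ.CliqueFree 3 :=
  SimpleGraph.Colorable.cliqueFree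
    (SimpleGraph.Coloring.mk c fun {x y} => hc x y).colorable (by simp)

theorem cliqueFree_S₁ : S₁.CliqueFree 3 :=
  cliqueFree_of_coloring (· ∈ [0, 3, 4, 5, 8, 9]) (by decide)

theorem cliqueFree_S₂ : S₂.CliqueFree 3 :=
  cliqueFree_of_coloring (· ∈ [0, 3, 4, 5, 6, 8]) (by decide)

theorem cliqueFree_S₁ext : S₁ext.CliqueFree 3 :=
  cliqueFree_of_coloring (· ∈ [0, 3, 4, 5, 7]) (by decide)

theorem cliqueFree_S₂ext : S₂ext.CliqueFree 3 :=
  cliqueFree_of_coloring (· ∈ [0, 1, 5, 6, 7, 9]) (by decide)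

theorem dominated_S₁_S₂ : Dominated S₁ 0 S₂ 0 10 :=
  dominated_of_pairStep_le cliqueFree_S₁ cliqueFree_S₂
    (by decide +kernel) (by decide +kernel) (by decide +kernel)

theorem dominated_S₂ext_S₁ext : Dominated S₂ext 0 S₁ext 0 10 :=
  dominated_of_pairStep_le cliqueFree_S₂ext cliqueFree_S₁ext
    (by decide +kernel) (by decide +kernel) (by decide +kernel)

theorem transfer_pow_eight_S₁_lt :
    (transfer S₁ Finset.univ ^ 8) 1 {0} < (transfer S₂ Finset.univ ^ 8) 1 {0} := by
  rw [transfer_pow_one_singleton cliqueFree_S₁, transfer_pow_one_singleton cliqueFree_S₂]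
  decide +kernel

theorem transfer_pow_eight_S₂ext_lt :
    (transfer S₂ext Finset.univ ^ 8) 1 {0} < (transfer S₁ext Finset.univ ^ 8) 1 {0} := by
  rw [transfer_pow_one_singleton cliqueFree_S₂ext, transfer_pow_one_singleton cliqueFree_S₁ext]
  decide +kernel

theorem growth_GeoStart_ext_eq_of_lt_eight {r : ℕ} (hr : r < 8) :
    growth (GeoStart S₁ext 0) r = growth (GeoStart S₂ext 0) r := by
  have counts_eq : ∀ k < 7, (pairStep S₁ext)^[k] (fun _ _ => 1) 0 0 =
      (pairStep S₂ext)^[k] (fun _ _ => 1) 0 0 := by decide +kernel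
  cases r with
  | zero => rw [growth_GeoStart_zero, growth_GeoStart_zero]
  | succ k =>
    rw [growth_GeoStart_succ, growth_GeoStart_succ, transfer_pow_one_singleton cliqueFree_S₁ext,
      transfer_pow_one_singleton cliqueFree_S₂ext, counts_eq k (by lia)]

theorem growth_GeoStart_S₁ext_eight : growth (GeoStart S₁ext 0) 8 = 8919523 := by
  rw [growth_GeoStart_succ, transfer_pow_one_singleton cliqueFree_S₁ext]
  decide +kernel

theorem growth_GeoStart_S₂ext_eight : growth (GeoStart S₂ext 0) 8 = 8919522 := by
  rw [growth_GeoStart_succ, transfer_pow_one_singleton cliqueFree_S₂ext]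
  decide +kernel

end Trees

section Roots

variable {V : Type*} [Finite V] {τ : SimpleGraph V} {a x : V}

theorem growth_coalescence_S₁_lt (hx : τ.Adj a x) :
    growth (Geo (coalescence τ a S₁ 0)) 10 < growth (Geo (coalescence τ a S₂ 0)) 10 :=
  dominated_S₁_S₂.growth_lt (k := 6) le_rfl transfer_pow_eight_S₁_lt hx

theorem growth_coalescence_S₂ext_lt (hx : τ.Adj a x) :
    growth (Geo (coalescence τ a S₂ext 0)) 10 < growth (Geo (coalescence τ a S₁ext 0)) 10 :=
  dominated_S₂ext_S₁ext.growth_lt (k := 6) le_rfl transfer_pow_eight_S₂ext_lt hx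

end Roots

theorem geodesicGrowthSeries_ne {V W : Type*} {Γ : SimpleGraph V} {Δ : SimpleGraph W} {r : ℕ}
    (h : growth (Geo Γ) r ≠ growth (Geo Δ) r) :
    geodesicGrowthSeries Γ ≠ geodesicGrowthSeries Δ := fun heq => h <| by
  simpa only [geodesicGrowthSeries, PowerSeries.coeff_mk] using congrArg (PowerSeries.coeff r) heq

theorem exists_adj_root {V : Type*} [Finite V] {τ : SimpleGraph V} (hτ : τ.IsTree)
    (hV : 2 ≤ Nat.card V) (a : V) : ∃ x, τ.Adj a x := by
  have : Nontrivial V := Finite.one_lt_card_iff_nontrivial.1 hV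
  exact hτ.connected.preconnected.exists_adj_of_nontrivial a

end RACG

end

theorem lemma5p2_general :
    (∀ (V : Type*) [Finite V] (τ : SimpleGraph V) (root x : V), τ.Adj root x →
      RACG.geodesicGrowthSeries (RACG.coalescence τ root RACG.S₁ 0) ≠
        RACG.geodesicGrowthSeries (RACG.coalescence τ root RACG.S₂ 0) ∧
      RACG.growth (RACG.Geo (RACG.coalescence τ root RACG.S₁ 0)) 10 ≠
        RACG.growth (RACG.Geo (RACG.coalescence τ root RACG.S₂ 0)) 10) ∧
    (∀ (V : Type*) [Finite V] (τ : SimpleGraph V) (root x : V), τ.Adj root x →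
      RACG.geodesicGrowthSeries (RACG.coalescence τ root RACG.S₁ext 0) ≠
        RACG.geodesicGrowthSeries (RACG.coalescence τ root RACG.S₂ext 0) ∧
      RACG.growth (RACG.Geo (RACG.coalescence τ root RACG.S₁ext 0)) 10 ≠
        RACG.growth (RACG.Geo (RACG.coalescence τ root RACG.S₂ext 0)) 10) ∧
    (∀ r < 8, RACG.growth (RACG.GeoStart RACG.S₁ext 0) r =
      RACG.growth (RACG.GeoStart RACG.S₂ext 0) r) ∧
    RACG.growth (RACG.GeoStart RACG.S₁ext 0) 8 = 8919523 ∧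
    RACG.growth (RACG.GeoEnd RACG.S₁ext 0) 8 = 8919523 ∧
    RACG.growth (RACG.GeoStart RACG.S₂ext 0) 8 = 8919522 ∧
    RACG.growth (RACG.GeoEnd RACG.S₂ext 0) 8 = 8919522 := by
  refine ⟨fun V _ τ root x hx => ?_, fun V _ τ root x hx => ?_,
    fun r hr => RACG.growth_GeoStart_ext_eq_of_lt_eight hr,
    RACG.growth_GeoStart_S₁ext_eight, ?_, RACG.growth_GeoStart_S₂ext_eight, ?_⟩
  · have hne := (RACG.growth_coalescence_S₁_lt hx).ne
    exact ⟨RACG.geodesicGrowthSeries_ne hne, hne⟩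
  · have hne := (RACG.growth_coalescence_S₂ext_lt hx).ne'
    exact ⟨RACG.geodesicGrowthSeries_ne hne, hne⟩
  · rw [RACG.growth_GeoEnd, RACG.growth_GeoStart_S₁ext_eight]
  · rw [RACG.growth_GeoEnd, RACG.growth_GeoStart_S₂ext_eight]

theorem lemma5p2 :
    -- the ten-vertex trees `S₁`, `S₂`
    (∀ (V : Type*) [Finite V] (τ : SimpleGraph V) (root : V), τ.IsTree → 2 ≤ Nat.card V →
      RACG.geodesicGrowthSeries (RACG.coalescence τ root RACG.S₁ 0) ≠
        RACG.geodesicGrowthSeries (RACG.coalescence τ root RACG.S₂ 0) ∧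
      RACG.growth (RACG.Geo (RACG.coalescence τ root RACG.S₁ 0)) 10 ≠
        RACG.growth (RACG.Geo (RACG.coalescence τ root RACG.S₂ 0)) 10) ∧
    -- the eleven-vertex trees, to which the counts below belong
    (∀ (V : Type*) [Finite V] (τ : SimpleGraph V) (root : V), τ.IsTree → 2 ≤ Nat.card V →
      RACG.geodesicGrowthSeries (RACG.coalescence τ root RACG.S₁ext 0) ≠
        RACG.geodesicGrowthSeries (RACG.coalescence τ root RACG.S₂ext 0) ∧
      RACG.growth (RACG.Geo (RACG.coalescence τ root RACG.S₁ext 0)) 10 ≠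
        RACG.growth (RACG.Geo (RACG.coalescence τ root RACG.S₂ext 0)) 10) ∧
    (∀ r < 8, RACG.growth (RACG.GeoStart RACG.S₁ext 0) r =
      RACG.growth (RACG.GeoStart RACG.S₂ext 0) r) ∧
    RACG.growth (RACG.GeoStart RACG.S₁ext 0) 8 = 8919523 ∧
    RACG.growth (RACG.GeoEnd RACG.S₁ext 0) 8 = 8919523 ∧
    RACG.growth (RACG.GeoStart RACG.S₂ext 0) 8 = 8919522 ∧
    RACG.growth (RACG.GeoEnd RACG.S₂ext 0) 8 = 8919522 := by
  obtain ⟨h, hext, hcounts⟩ := lemma5p2_general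
  exact ⟨fun V _ τ root hτ hV => (RACG.exists_adj_root hτ hV root).elim (h V τ root),
    fun V _ τ root hτ hV => (RACG.exists_adj_root hτ hV root).elim (hext V τ root), hcounts⟩
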